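/- Let $N$ be a finite set and let $\mathbb{R}^{\mathcal P(N)}$ be the space of real functions on the power set $\mathcal P(N)$. For $S\subseteq N$ let $\chi_S\in\mathbb{R}^N$ be its incidence vector; $\subset$ denotes strict inclusion, and a conic hull consists of all finite combinations with non-negative coefficients. For a set system $\mathcal B\subseteq\mathcal P(N)$ call $\bigcup\mathcal B$ its carrier. A non-empty system $\mathcal B$ with carrier $M$ is *min-balanced* (on $M$) if it is an inclusion-minimal set system such that $\chi_M$ belongs to the conic hull of $\{\chi_S: S\in\mathcal B\}$ (with $M$ fixed); it is *non-trivial* if $|\mathcal B|\ge 2$. A min-balanced system $\mathcal B$ is *reducible* if there exist $A\subset\bigcup\mathcal B$ and $B\in\mathcal B_A:=\{S\in\mathcal B: S\subset A\}$ such that $\chi_A$ is in the conic hull of $\{\chi_S: S\in\mathcal B_A\}$ and $\chi_{\bigcup\mathcal B}$ is in the conic hull of $\{\chi_T: T\in\{A\}\cup(\mathcal B\setminus\{B\})\}$; otherwise it is *irreducible*. For a non-trivial min-balanced system $\mathcal B$ on $M$ there are unique $\lambda_S>0$ $(S\in\mathcal B)$ with $\chi_M=\sum_{S\in\mathcal B}\lambda_S\chi_S$,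 and a unique integer $k\ge 1$ such that the numbers $k\lambda_S$ $(S\in\mathcal B)$ are integers with greatest common divisor $1$. Define $\alpha_{\mathcal B}\in\mathbb{R}^{\mathcal P(N)}$ by $\alpha_{\mathcal B}(M)=k$, $\alpha_{\mathcal B}(S)=-k\lambda_S$ for $S\in\mathcal B$, $\alpha_{\mathcal B}(\emptyset)=-k+k\sum_{S\in\mathcal B}\lambda_S$, and $\alpha_{\mathcal B}(S)=0$ otherwise. For $M\subseteq N$ with $|M|\ge 2$ let $\Delta_M$ be the set of $\theta\in\mathbb{R}^{\mathcal P(N)}$ such that $\theta(S)\le 0$ for $\emptyset\ne S\subset M$, $\theta(R)=0$ for $R\subseteq N$ with $R\setminus M\neq\emptyset$, $\theta(\emptyset)=1$, $\sum_{S\subseteq N}\theta(S)=0$, and $\sum_{T\subseteq N:\, i\in T}\theta(T)=0$ for every $i\in N$. Let $\Delta$ be the convex hull of $\bigcup_{M\subseteq N,\,|M|\ge 2}\Delta_M$. **Lemma.** A vector $\theta\in\mathbb{R}^{\mathcal P(N)}$ is an extreme point of $\Delta$ if and only if $\theta=\alpha_{\mathcal B}(\emptyset)^{-1}\cdot\alpha_{\mathcal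 B}$ for some non-trivial irreducible min-balanced system $\mathcal B$ on some $M\subseteq N$ with $|M|\ge 2$. -/

import Mathlib

namespace MinBalanced

variable {N : Type*} [DecidableEq N]

/-- The incidence vector of a coalition. -/
def chi (S : Finset N) : N → ℝ := fun i => if i ∈ S then 1 else 0

/-- The union of the sets of a set system. -/
def carrier (B : Finset (Finset N)) : Finset N := B.biUnion id

/-- The conic hull (all finite non-negative combinations, including zero) of the incidence
vectors of the sets in a set system. -/
def cone (B : Finset (Finset N)) : PointedCone ℝ (N → ℝ) :=
  PointedCone.hull ℝ (chi '' (B : Set (Finset N)))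

/-- A non-empty set system `B` with carrier `M` is min-balanced if it is an inclusion-minimal set
system whose incidence vectors have the incidence vector of `M` in their conic hull. -/
def IsMinBalanced (B : Finset (Finset N)) : Prop :=
  B.Nonempty ∧ Minimal (fun C : Finset (Finset N) => chi (carrier B) ∈ cone C) B

/-- A min-balanced system whose carrier is `M`. -/
def IsMinBalancedOn (B : Finset (Finset N)) (M : Finset N) : Prop :=
  IsMinBalanced B ∧ carrier B = M

/-- A non-trivial system has at least two sets. -/
def IsNontrivial (B : Finset (Finset N)) : Prop := 2 ≤ B.card

/-- The system of those sets of `B` that are strictly included in `A`. -/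
def below (B : Finset (Finset N)) (A : Finset N) : Finset (Finset N) :=
  B.filter (fun S => S ⊂ A)

/-- Reducibility of a (min-balanced) system. -/
def IsReducible (B : Finset (Finset N)) : Prop :=
  ∃ A : Finset N, A ⊂ carrier B ∧ ∃ T ∈ below B A,
    chi A ∈ cone (below B A) ∧ chi (carrier B) ∈ cone (insert A (B.erase T))

/-- An irreducible min-balanced system. -/
def IsIrreducible (B : Finset (Finset N)) : Prop :=
  IsMinBalanced B ∧ ¬ IsReducible B

/-- `w` is a vector of balancing weights of `B`: strictly positive on `B` (and, as a normalization,
zero off `B`), expressing the incidence vector of the carrier. -/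
def IsWeight (B : Finset (Finset N)) (w : Finset N → ℝ) : Prop :=
  (∀ S ∈ B, 0 < w S) ∧ (∀ S ∉ B, w S = 0) ∧ chi (carrier B) = ∑ S ∈ B, w S • chi S

theorem mem_cone_of_eq {B : Finset (Finset N)} {x : N → ℝ} {c : Finset N → ℝ}
    (hc : ∀ S ∈ B, 0 ≤ c S) (hx : x = ∑ S ∈ B, c S • chi S) : x ∈ cone B := by
  rw [hx]
  refine Submodule.sum_mem _ fun S hS => ?_
  exact Submodule.smul_mem (cone B) (⟨c S, hc S hS⟩ : {r : ℝ // 0 ≤ r})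
    (Submodule.subset_span ⟨S, hS, rfl⟩)

theorem exists_of_mem_cone {B : Finset (Finset N)} {x : N → ℝ} (hx : x ∈ cone B) :
    ∃ c : Finset N → ℝ, (∀ S ∈ B, 0 ≤ c S) ∧ x = ∑ S ∈ B, c S • chi S := by
  induction hx using Submodule.span_induction with
  | mem x h =>
    obtain ⟨S, hS, rfl⟩ := h
    refine ⟨fun T => if T = S then 1 else 0, fun T _ => ?_, ?_⟩
    · dsimp only; split_ifs <;> norm_num
    · have hS' : S ∈ B := hS
      simp [ite_smul, hS']
  | zero => exact ⟨0, by simp, by simp⟩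
  | add x y _ _ hx hy =>
    obtain ⟨c, hc, rfl⟩ := hx
    obtain ⟨d, hd, rfl⟩ := hy
    exact ⟨c + d, fun S hS => add_nonneg (hc S hS) (hd S hS), by
      simp [add_smul, Finset.sum_add_distrib]⟩
  | smul r x _ hx =>
    obtain ⟨c, hc, rfl⟩ := hx
    refine ⟨fun S => r.1 * c S, fun S hS => mul_nonneg r.2 (hc S hS), ?_⟩
    rw [Finset.smul_sum]
    refine Finset.sum_congr rfl fun S _ => ?_
    rw [mul_smul]; rfl

/-- In a min-balanced system every conic representation of the carrier is positive. -/
theorem pos_of_isMinBalanced {B : Finset (Finset N)} (hB : IsMinBalanced B) {c : Finset N → ℝ}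
    (hc : ∀ S ∈ B, 0 ≤ c S) (hx : chi (carrier B) = ∑ S ∈ B, c S • chi S) :
    ∀ S ∈ B, 0 < c S := by
  intro S hS
  refine lt_of_le_of_ne (hc S hS) fun h0 => ?_
  have hmem : chi (carrier B) ∈ cone (B.erase S) := by
    refine mem_cone_of_eq (c := c) (fun T hT => hc T (Finset.mem_of_mem_erase hT)) ?_
    rw [hx, ← Finset.add_sum_erase B _ hS, ← h0, zero_smul, zero_add]
  exact Finset.notMem_erase S B (hB.2.le_of_le hmem (Finset.erase_subset S B) hS)

theorem exists_isWeight {B : Finset (Finset N)} (hB : IsMinBalanced B) :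
    ∃ w, IsWeight B w := by
  obtain ⟨c, hc, hx⟩ := exists_of_mem_cone hB.2.prop
  have hp := pos_of_isMinBalanced hB hc hx
  refine ⟨fun S => if S ∈ B then c S else 0, fun S hS => by simpa [hS] using hp S hS,
    fun S hS => by simp [hS], ?_⟩
  rw [hx]
  exact Finset.sum_congr rfl fun S hS => by simp [hS]

/-- The real coefficients of the representation of the carrier are unique. -/
theorem eq_of_isMinBalanced {B : Finset (Finset N)} (hB : IsMinBalanced B) {w v : Finset N → ℝ}
    (hw : IsWeight B w) (hv : chi (carrier B) = ∑ S ∈ B, v S • chi S) :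
    ∀ S ∈ B, v S = w S := by
  have key : ∀ d : Finset N → ℝ, ∑ S ∈ B, d S • chi S = 0 → ∀ S ∈ B, 0 ≤ d S := by
    intro d hd S hS
    by_contra hneg
    push Not at hneg
    obtain ⟨T, hT, hmin⟩ := (B.filter fun S => d S < 0).exists_min_image
      (fun S => w S / (-d S)) ⟨S, by simp [hS, hneg]⟩
    rw [Finset.mem_filter] at hT
    have hdT : 0 < -d T := by linarith [hT.2]
    set e := w T / (-d T) with he
    have he0 : 0 < e := div_pos (hw.1 T hT.1) hdT
    have h := pos_of_isMinBalanced hB (c := fun S => w S + e * d S) (fun U hU => ?_) ?_ T hT.1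
    · have : e * (-d T) = w T := div_mul_cancel₀ _ hdT.ne'
      linarith
    · by_cases hdU : d U < 0
      · have := hmin U (by simp [hU, hdU])
        rw [le_div_iff₀ (by linarith)] at this
        linarith
      · push Not at hdU
        have := hw.1 U hU
        positivity
    · simp only [add_smul, Finset.sum_add_distrib, mul_smul, ← Finset.smul_sum, hd, smul_zero,
        add_zero]
      exact hw.2.2
  intro S hS
  have h1 : ∑ S ∈ B, (v - w) S • chi S = 0 := by
    simp only [Pi.sub_apply, sub_smul, Finset.sum_sub_distrib, ← hv, ← hw.2.2, sub_self]
  have h2 : ∑ S ∈ B, (w - v) S • chi S = 0 := by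
    simp only [Pi.sub_apply, sub_smul, Finset.sum_sub_distrib, ← hv, ← hw.2.2, sub_self]
  have h3 := key _ h1 S hS
  have h4 := key _ h2 S hS
  simp only [Pi.sub_apply] at h3 h4
  linarith

/-- The balancing weights of a min-balanced system exist and are unique. -/
theorem existsUnique_isWeight {B : Finset (Finset N)} (hB : IsMinBalanced B) :
    ∃! w, IsWeight B w := by
  obtain ⟨w, hw⟩ := exists_isWeight hB
  refine ⟨w, hw, fun v hv => funext fun S => ?_⟩
  by_cases hS : S ∈ B
  · exact eq_of_isMinBalanced hB hw hv.2.2 S hS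
  · rw [hv.2.1 S hS, hw.2.1 S hS]

open Classical in
/-- The balancing weights of `B`, which exist and are unique for a min-balanced `B`. -/
noncomputable def weight (B : Finset (Finset N)) : Finset N → ℝ :=
  if h : ∃ w, IsWeight B w then h.choose else 0

theorem isWeight_weight {B : Finset (Finset N)} (hB : IsMinBalanced B) :
    IsWeight B (weight B) := by
  have h := exists_isWeight hB
  rw [weight, dif_pos h]
  exact h.choose_spec

/-- `k ≥ 1` is such that the numbers `k * weight B S`, for `S ∈ B`, are integers that are
(jointly) relatively prime. -/
def IsScale (B : Finset (Finset N)) (k : ℕ) : Prop :=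
  1 ≤ k ∧ ∃ z : Finset N → ℤ, (∀ S ∈ B, (z S : ℝ) = k * weight B S) ∧ B.gcd z = 1

theorem exists_rat_weight {B : Finset (Finset N)} (hB : IsMinBalanced B) :
    ∃ q : Finset N → ℚ, ∀ S ∈ B, (q S : ℝ) = weight B S := by
  have hw := isWeight_weight hB
  obtain ⟨f, hf⟩ := (Algebra.linearMap ℚ ℝ).exists_leftInverse_of_injective
    (LinearMap.ker_eq_bot.mpr (algebraMap ℚ ℝ).injective)
  have hf1 : ∀ r : ℚ, f (r : ℝ) = r := fun r => by
    simpa using LinearMap.congr_fun hf r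
  refine ⟨fun S => f (weight B S), eq_of_isMinBalanced hB hw ?_⟩
  funext i
  have h := congrFun hw.2.2 i
  simp only [Finset.sum_apply, Pi.smul_apply, smul_eq_mul, chi, mul_ite, mul_one, mul_zero] at h ⊢
  have h' := congrArg f h
  rw [map_sum] at h'
  have h0 : ∀ (p : Prop) [Decidable p], f (if p then 1 else 0) = if p then 1 else 0 := by
    intro p _
    split_ifs
    · simpa using hf1 1
    · simp
  rw [h0] at h'
  have h'' := congrArg (fun r : ℚ => (r : ℝ)) h'
  simp only [Rat.cast_sum, apply_ite f, map_zero, apply_ite (fun r : ℚ => (r : ℝ)), Rat.cast_one,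
    Rat.cast_zero] at h''
  exact h''

theorem exists_mem_carrier {B : Finset (Finset N)} (hB : IsMinBalanced B) :
    ∃ i, i ∈ carrier B := by
  by_contra h
  push Not at h
  have h0 : chi (carrier B) = 0 := funext fun i => by simp [chi, h i]
  obtain ⟨S, hS⟩ := hB.1
  have hmem : chi (carrier B) ∈ cone (∅ : Finset (Finset N)) := by
    rw [h0]; exact Submodule.zero_mem _
  exact Finset.notMem_empty S (hB.2.le_of_le hmem (Finset.empty_subset B) hS)

theorem sum_weight {B : Finset (Finset N)} (hB : IsMinBalanced B) {i : N} (hi : i ∈ carrier B) :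
    ∑ S ∈ B with i ∈ S, weight B S = 1 := by
  have h := congrFun (isWeight_weight hB).2.2 i
  simp only [Finset.sum_apply, Pi.smul_apply, smul_eq_mul, chi, mul_ite, mul_one, mul_zero, hi,
    if_true] at h
  rw [Finset.sum_filter, ← h]

theorem exists_isScale {B : Finset (Finset N)} (hB : IsMinBalanced B) : ∃ k, IsScale B k := by
  obtain ⟨q, hq⟩ := exists_rat_weight hB
  obtain ⟨i, hi⟩ := exists_mem_carrier hB
  obtain ⟨D, hD, y, hy⟩ : ∃ D : ℕ, 1 ≤ D ∧ ∃ y : Finset N → ℤ,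
      ∀ S ∈ B, (y S : ℝ) = D * weight B S := by
    refine ⟨∏ S ∈ B, (q S).den, Finset.one_le_prod' fun S _ => (q S).pos,
      fun S => (∏ T ∈ B.erase S, ((q T).den : ℤ)) * (q S).num, fun S hS => ?_⟩
    rw [← hq S hS, ← Finset.mul_prod_erase B _ hS]
    have h1 : ((q S).den : ℝ) * (q S : ℝ) = ((q S).num : ℝ) := by
      exact_mod_cast Rat.den_mul_eq_num (q S)
    push_cast
    rw [← h1]
    ring
  have hsum : (D : ℤ) = ∑ S ∈ B with i ∈ S, y S := by
    have h : (D : ℝ) = ∑ S ∈ B with i ∈ S, (y S : ℝ) := by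
      rw [Finset.sum_congr rfl fun S hS => hy S (Finset.mem_filter.mp hS).1, ← Finset.mul_sum,
        sum_weight hB hi, mul_one]
    exact_mod_cast h
  obtain ⟨S₀, hS₀⟩ := hB.1
  obtain ⟨z, hz, hgcd⟩ := Finset.extract_gcd y ⟨S₀, hS₀⟩
  set g := B.gcd y with hg
  have hgD : g ∣ (D : ℤ) := by
    rw [hsum]
    exact Finset.dvd_sum fun S hS => Finset.gcd_dvd (Finset.mem_filter.mp hS).1
  obtain ⟨k, hk⟩ := hgD
  have hg0 : 0 ≤ g := by
    have h := Finset.normalize_gcd (s := B) (f := y)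
    rw [← hg] at h
    rw [← h, ← Int.abs_eq_normalize]
    exact abs_nonneg g
  have hDpos : (0 : ℤ) < D := by exact_mod_cast hD
  have hgpos : 0 < g := lt_of_le_of_ne hg0 fun h => by
    rw [hk, ← h, zero_mul] at hDpos; exact lt_irrefl _ hDpos
  have hkpos : 0 < k := by
    rw [hk] at hDpos
    exact pos_of_mul_pos_right hDpos hg0
  refine ⟨k.toNat, by omega, z, fun S hS => ?_, hgcd⟩
  have hkk : ((k.toNat : ℕ) : ℝ) = (k : ℝ) := by
    exact_mod_cast Int.toNat_of_nonneg hkpos.le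
  have h1 := hy S hS
  have h2 : (D : ℝ) = g * k := by exact_mod_cast hk
  rw [hz S hS, h2] at h1
  push_cast at h1
  have hgr : (g : ℝ) ≠ 0 := by exact_mod_cast hgpos.ne'
  rw [hkk]
  refine mul_left_cancel₀ hgr ?_
  rw [h1]; ring

/-- The scaling factor of a min-balanced system exists and is unique. -/
theorem existsUnique_isScale {B : Finset (Finset N)} (hB : IsMinBalanced B) :
    ∃! k, IsScale B k := by
  have key : ∀ k l : ℕ, IsScale B k → IsScale B l → (k : ℤ) ∣ l := by
    rintro k l ⟨hk, z, hz, hzg⟩ ⟨hl, y, hy, hyg⟩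
    have h : ∀ S ∈ B, (k : ℤ) ∣ l * z S := fun S hS => ⟨y S, by
      have : (l : ℝ) * z S = k * y S := by rw [hz S hS, hy S hS]; ring
      exact_mod_cast this⟩
    have h2 := Finset.dvd_gcd h
    rw [Finset.gcd_mul_left, hzg, mul_one] at h2
    exact (dvd_normalize_iff).mp h2
  obtain ⟨k, hk⟩ := exists_isScale hB
  refine ⟨k, hk, fun l hl => ?_⟩
  exact Nat.dvd_antisymm (by exact_mod_cast key l k hl hk) (by exact_mod_cast key k l hk hl)

open Classical in
/-- The scaling factor, which exists and is unique for a min-balanced `B`. -/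
noncomputable def scale (B : Finset (Finset N)) : ℕ :=
  if h : ∃ k, IsScale B k then h.choose else 0

theorem isScale_scale {B : Finset (Finset N)} (hB : IsMinBalanced B) :
    IsScale B (scale B) := by
  have h := exists_isScale hB
  rw [scale, dif_pos h]
  exact h.choose_spec

/-- The coefficient vector `α_B` of a non-trivial min-balanced system `B`. -/
noncomputable def alpha (B : Finset (Finset N)) : Finset N → ℝ := fun S =>
  if S = carrier B then (scale B : ℝ)
  else if S ∈ B then -((scale B : ℝ) * weight B S)
  else if S = ∅ then -(scale B : ℝ) + (scale B : ℝ) * ∑ T ∈ B, weight B T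
  else 0

variable [Fintype N]

/-- The polytope `Δ_M`. -/
def DeltaOn (M : Finset N) : Set (Finset N → ℝ) :=
  {θ | (∀ S : Finset N, S.Nonempty → S ⊂ M → θ S ≤ 0) ∧
    (∀ R : Finset N, (R \ M).Nonempty → θ R = 0) ∧
    θ ∅ = 1 ∧ ∑ S : Finset N, θ S = 0 ∧
    ∀ i : N, ∑ T : Finset N with i ∈ T, θ T = 0}

variable (N) in
/-- The polytope `Δ`, the convex hull of all `Δ_M` with `M` of cardinality at least two. -/
def Delta : Set (Finset N → ℝ) :=
  convexHull ℝ (⋃ M ∈ {M : Finset N | 2 ≤ M.card}, DeltaOn M)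

end MinBalanced

namespace MinBalanced

open Finset

/-! Drop the normalization at `∅` from `DeltaOn M` to get the cone `coneOn M`. On it the value at
`∅` is non-negative and vanishes only at zero (`apply_empty_nonneg`), so extreme points of `Delta`
behave like extreme rays of the sum of all these cones. A vector of `coneOn M` with value 1 at `M`
encodes a conic representation of `chi M` by non-empty proper subsets; extremality inside one cone
means a minimal support, that is, a min-balanced system. Irreducibility says that the ray does not
split across different cones.

Extreme implies irreducible: a smaller balanced subsystem, or a reduction through a set `A`, splits
the vector into two cone elements, which `eq_smul_of_add_eq` forces to be proportional to it; this
fails at a suitable set. Conversely, in any splitting of the vector of an irreducible system all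
components outside the carrier's cone vanish (`eq_zero_of_sum_eq`), and uniqueness of balancing
weights settles the remaining cone (`eq_smul_vec`). -/

theorem exists_pos_forall_mul_le {ι : Type*} (B : Finset ι) (c d : ι → ℝ)
    (hd : ∀ S ∈ B, 0 < d S) : ∃ ε : ℝ, 0 < ε ∧ ∀ S ∈ B, ε * c S ≤ d S := by
  have h : ∀ᶠ ε : ℝ in nhdsWithin 0 (Set.Ioi 0), ∀ S ∈ B, ε * c S ≤ d S := by
    rw [Filter.eventually_all_finset]
    intro S hS
    have ht : Filter.Tendsto (fun ε : ℝ => ε * c S) (nhdsWithin 0 (Set.Ioi 0)) (nhds 0) := by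
      have : Continuous fun ε : ℝ => ε * c S := by fun_prop
      simpa using (this.tendsto 0).mono_left nhdsWithin_le_nhds
    filter_upwards [ht.eventually_lt_const (hd S hS)] with ε hε using hε.le
  obtain ⟨ε, h1, h2⟩ := (h.and self_mem_nhdsWithin).exists
  exact ⟨ε, h2, h1⟩

variable {N : Type*} [DecidableEq N]

/-! ### Min-balanced systems: members and weights. -/

theorem mem_carrier {B : Finset (Finset N)} {i : N} : i ∈ carrier B ↔ ∃ S ∈ B, i ∈ S := by
  simp [carrier]

theorem subset_carrier {B : Finset (Finset N)} {S : Finset N} (hS : S ∈ B) : S ⊆ carrier B :=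
  fun _ hi => mem_carrier.2 ⟨S, hS, hi⟩

theorem chi_empty : chi (∅ : Finset N) = 0 := by
  funext i; simp [chi]

theorem IsMinBalanced.nonempty_of_mem {B : Finset (Finset N)} (hB : IsMinBalanced B)
    {S : Finset N} (hS : S ∈ B) : S.Nonempty := by
  rw [nonempty_iff_ne_empty]
  rintro rfl
  obtain ⟨c, hc, hx⟩ := exists_of_mem_cone hB.2.prop
  have hmem : chi (carrier B) ∈ cone (B.erase ∅) := by
    refine mem_cone_of_eq (c := c) (fun T hT => hc T (mem_of_mem_erase hT)) ?_
    rw [hx, ← add_sum_erase B _ hS, chi_empty, smul_zero, zero_add]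
  exact notMem_erase ∅ B (hB.2.le_of_le hmem (erase_subset _ B) hS)

theorem IsMinBalanced.ssubset_of_mem {B : Finset (Finset N)} (hB : IsMinBalanced B)
    (hn : IsNontrivial B) {S : Finset N} (hS : S ∈ B) : S ⊂ carrier B := by
  refine (subset_carrier hS).ssubset_of_ne fun h => ?_
  have hmem : chi (carrier B) ∈ cone {S} := by
    rw [← h]
    exact Submodule.subset_span ⟨S, by simp, rfl⟩
  have hle := hB.2.le_of_le hmem (by simpa using hS)
  have h1 := card_le_card hle
  have h2 : 2 ≤ B.card := hn
  simp at h1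
  omega

theorem IsWeight.nonneg {B : Finset (Finset N)} {w : Finset N → ℝ} (hw : IsWeight B w)
    (S : Finset N) : 0 ≤ w S := by
  by_cases hS : S ∈ B
  · exact (hw.1 S hS).le
  · exact (hw.2.1 S hS).ge

theorem IsMinBalanced.carrier_nonempty {B : Finset (Finset N)} (hB : IsMinBalanced B) :
    (carrier B).Nonempty := exists_mem_carrier hB

variable [Fintype N]

theorem mem_cone_iff {B : Finset (Finset N)} {x : N → ℝ} :
    x ∈ cone B ↔ ∃ c : Finset N → ℝ, (∀ S, 0 ≤ c S) ∧ (∀ S ∉ B, c S = 0) ∧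
      x = ∑ S, c S • chi S := by
  constructor
  · intro hx
    obtain ⟨c, hc, h⟩ := exists_of_mem_cone hx
    refine ⟨fun S => if S ∈ B then c S else 0, fun S => ?_, fun S hS => by simp [hS], ?_⟩
    · dsimp only
      split_ifs with hS
      exacts [hc S hS, le_rfl]
    · simp [h, ite_smul]
  · rintro ⟨c, hc, h0, h⟩
    refine mem_cone_of_eq (c := c) (fun S _ => hc S) ?_
    rw [h]
    exact (sum_subset (subset_univ B) fun S _ hS => by simp [h0 S hS]).symm

theorem IsWeight.chi_carrier {B : Finset (Finset N)} {w : Finset N → ℝ} (hw : IsWeight B w) :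
    chi (carrier B) = ∑ S, w S • chi S := by
  rw [hw.2.2]
  exact sum_subset (subset_univ B) fun S _ hS => by simp [hw.2.1 S hS]

theorem IsWeight.eq_of_sum_eq {B : Finset (Finset N)} (hB : IsMinBalanced B)
    {w v : Finset N → ℝ} (hw : IsWeight B w) (h0 : ∀ S ∉ B, v S = 0)
    (hv : chi (carrier B) = ∑ S, v S • chi S) : v = w := by
  funext S
  by_cases hS : S ∈ B
  · refine eq_of_isMinBalanced hB hw ?_ S hS
    rw [hv]
    exact (sum_subset (subset_univ B) fun S _ hS => by simp [h0 S hS]).symm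
  · rw [h0 S hS, hw.2.1 S hS]

/-! ### The cones over the polytopes. -/

/-- The cone spanned by the polytope `DeltaOn M`. -/
def coneOn (M : Finset N) : Set (Finset N → ℝ) :=
  {θ | (∀ S : Finset N, S.Nonempty → S ⊂ M → θ S ≤ 0) ∧
    (∀ R : Finset N, ¬ R ⊆ M → θ R = 0) ∧ ∑ S, θ S = 0 ∧ ∑ S, θ S • chi S = 0}

theorem sum_smul_chi_apply (θ : Finset N → ℝ) (i : N) :
    (∑ S, θ S • chi S) i = ∑ T with i ∈ T, θ T := by
  simp [chi, sum_filter]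

theorem mem_deltaOn_iff {M : Finset N} {θ : Finset N → ℝ} :
    θ ∈ DeltaOn M ↔ θ ∈ coneOn M ∧ θ ∅ = 1 := by
  have h : (∑ S, θ S • chi S = 0) ↔ ∀ i : N, ∑ T with i ∈ T, θ T = 0 := by
    rw [funext_iff]
    simp only [sum_smul_chi_apply, Pi.zero_apply]
  simp only [DeltaOn, coneOn, Set.mem_ofPred_eq, h, sdiff_nonempty]
  tauto

theorem zero_mem_coneOn (M : Finset N) : (0 : Finset N → ℝ) ∈ coneOn M := by
  simp [coneOn]

theorem add_mem_coneOn {M : Finset N} {x y : Finset N → ℝ} (hx : x ∈ coneOn M)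
    (hy : y ∈ coneOn M) : x + y ∈ coneOn M := by
  refine ⟨fun S h1 h2 => add_nonpos (hx.1 S h1 h2) (hy.1 S h1 h2), fun R hR => ?_, ?_, ?_⟩
  · simp [hx.2.1 R hR, hy.2.1 R hR]
  · simp [sum_add_distrib, hx.2.2.1, hy.2.2.1]
  · simp [sum_add_distrib, add_smul, hx.2.2.2, hy.2.2.2]

theorem smul_mem_coneOn {M : Finset N} {x : Finset N → ℝ} {r : ℝ} (hr : 0 ≤ r)
    (hx : x ∈ coneOn M) : r • x ∈ coneOn M := by
  refine ⟨fun S h1 h2 => mul_nonpos_of_nonneg_of_nonpos hr (hx.1 S h1 h2), fun R hR => ?_, ?_, ?_⟩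
  · simp [hx.2.1 R hR]
  · simp [← mul_sum, hx.2.2.1]
  · simp [mul_smul, ← smul_sum, hx.2.2.2]

theorem sum_filter_mem_of_mem_coneOn {M : Finset N} {x : Finset N → ℝ} (hx : x ∈ coneOn M)
    {i : N} (hi : i ∈ M) : x M + ∑ T ∈ ({T | i ∈ T} : Finset (Finset N)).erase M, x T = 0 := by
  rw [add_sum_erase _ _ (by simpa using hi), ← sum_smul_chi_apply, hx.2.2.2, Pi.zero_apply]

theorem apply_nonpos_of_mem_coneOn {M : Finset N} {x : Finset N → ℝ} (hx : x ∈ coneOn M)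
    {S : Finset N} (hS : S.Nonempty) (hSM : S ≠ M) : x S ≤ 0 := by
  by_cases h : S ⊆ M
  · exact hx.1 S hS (h.ssubset_of_ne hSM)
  · exact (hx.2.1 S h).le

theorem eq_zero_of_forall_nonempty {M : Finset N} {x : Finset N → ℝ} (hx : x ∈ coneOn M)
    (h : ∀ S : Finset N, S.Nonempty → x S = 0) : x = 0 := by
  funext S
  obtain rfl | hS := S.eq_empty_or_nonempty
  · have h1 := hx.2.2.1
    rwa [sum_eq_single ∅ (fun S _ hS => h S (nonempty_iff_ne_empty.2 hS)) (by simp)] at h1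
  · exact h S hS

/-- For each `i ∈ M` the values at the sets containing `i` sum to zero, and only the value at `M`
can be positive. -/
theorem eq_zero_of_apply_self {M : Finset N} {x : Finset N → ℝ} (hx : x ∈ coneOn M)
    (h0 : x M = 0) : x = 0 := by
  refine eq_zero_of_forall_nonempty hx fun S hS => ?_
  by_cases hSM : S = M
  · rw [hSM, h0]
  by_cases hsub : S ⊆ M
  · obtain ⟨i, hi⟩ := hS
    have h := sum_filter_mem_of_mem_coneOn hx (hsub hi)
    rw [h0, zero_add, sum_eq_zero_iff_of_nonpos] at h
    · exact h S (by simp [hSM, hi])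
    · intro T hT
      simp only [mem_erase, mem_filter, mem_univ, true_and] at hT
      exact apply_nonpos_of_mem_coneOn hx ⟨i, hT.2⟩ hT.1
  · exact hx.2.1 S hsub

theorem eq_zero_of_mem_coneOn_empty {x : Finset N → ℝ} (hx : x ∈ coneOn (∅ : Finset N)) :
    x = 0 :=
  eq_zero_of_forall_nonempty hx fun S hS => hx.2.1 S (by simpa using hS.ne_empty)

theorem apply_self_nonneg {M : Finset N} {x : Finset N → ℝ} (hx : x ∈ coneOn M) : 0 ≤ x M := by
  obtain rfl | ⟨i, hi⟩ := M.eq_empty_or_nonempty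
  · simp [eq_zero_of_mem_coneOn_empty hx]
  · have h := sum_filter_mem_of_mem_coneOn hx hi
    have h2 : ∑ T ∈ ({T | i ∈ T} : Finset (Finset N)).erase M, x T ≤ 0 := by
      refine sum_nonpos fun T hT => ?_
      simp only [mem_erase, mem_filter, mem_univ, true_and] at hT
      exact apply_nonpos_of_mem_coneOn hx ⟨i, hT.2⟩ hT.1
    linarith

theorem sum_mul_card_of_mem_coneOn {M : Finset N} {x : Finset N → ℝ} (hx : x ∈ coneOn M) :
    ∑ S, x S * ((M.card : ℝ) - S.card) = 0 := by
  have h1 : ∑ S, x S * (S.card : ℝ) = 0 := by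
    have h := congrArg (fun f : N → ℝ => ∑ i, f i) hx.2.2.2
    simp only [Finset.sum_apply, Pi.smul_apply, smul_eq_mul, Pi.zero_apply, sum_const_zero] at h
    rw [sum_comm] at h
    rw [← h]
    refine sum_congr rfl fun S _ => ?_
    simp [chi, mul_comm]
  simp only [mul_sub, sum_sub_distrib, ← sum_mul, hx.2.2.1, h1]
  simp

/-- Weight each set `S` by `|M| - |S|`: the weighted values sum to zero, and every non-empty set
contributes a non-positive term, so the term of `∅` balances them. -/
theorem apply_empty_nonneg {M : Finset N} {x : Finset N → ℝ} (hx : x ∈ coneOn M) :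
    0 ≤ x ∅ ∧ (x ∅ = 0 → x = 0) := by
  obtain rfl | hM := M.eq_empty_or_nonempty
  · simp [eq_zero_of_mem_coneOn_empty hx]
  have h := sum_mul_card_of_mem_coneOn hx
  rw [← add_sum_erase _ _ (mem_univ ∅)] at h
  have hMc : (0 : ℝ) < M.card := by exact_mod_cast hM.card_pos
  have hle : ∀ S ∈ (univ : Finset (Finset N)).erase ∅,
      x S * ((M.card : ℝ) - S.card) ≤ 0 := by
    intro S hS
    have hS' : S.Nonempty := nonempty_iff_ne_empty.2 (ne_of_mem_erase hS)
    by_cases hsub : S ⊆ M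
    · by_cases hSM : S = M
      · simp [hSM]
      · have : (S.card : ℝ) ≤ M.card := by exact_mod_cast card_le_card hsub
        exact mul_nonpos_of_nonpos_of_nonneg (apply_nonpos_of_mem_coneOn hx hS' hSM)
          (by linarith)
    · simp [hx.2.1 S hsub]
  have hsum := sum_nonpos hle
  rw [card_empty, Nat.cast_zero, sub_zero] at h
  refine ⟨?_, fun h0 => ?_⟩
  · by_contra hneg
    push Not at hneg
    nlinarith [mul_neg_of_neg_of_pos hneg hMc]
  · rw [h0, zero_mul, zero_add, sum_eq_zero_iff_of_nonpos hle] at h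
    have hS0 : ∀ S : Finset N, S.Nonempty → S ≠ M → x S = 0 := by
      intro S hS hSM
      by_cases hsub : S ⊆ M
      · have h1 := h S (by simp [hS.ne_empty])
        have h2 : (S.card : ℝ) < M.card := by
          exact_mod_cast card_lt_card (hsub.ssubset_of_ne hSM)
        rcases mul_eq_zero.1 h1 with h3 | h3
        · exact h3
        · linarith
      · exact hx.2.1 S hsub
    refine eq_zero_of_apply_self hx ?_
    have h1 := hx.2.2.1
    rwa [sum_eq_single M ?_ (by simp)] at h1
    intro S _ hSM
    obtain rfl | hS := S.eq_empty_or_nonempty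
    exacts [h0, hS0 S hS hSM]

/-! ### Vectors of conic representations, and `alpha`. -/

/-- The vector with value `1` at `M`, value `-c S` at the sets `S` in the support of `c`, and total
sum zero. -/
noncomputable def vec (M : Finset N) (c : Finset N → ℝ) : Finset N → ℝ := fun S =>
  (if S = M then 1 else 0) - c S + if S = ∅ then ∑ T, c T - 1 else 0

/-- Non-negative coefficients, vanishing off the non-empty proper subsets of `M`, that represent
the incidence vector of `M`. -/
structure IsRepr (M : Finset N) (c : Finset N → ℝ) : Prop where
  nonneg : ∀ S, 0 ≤ c S
  eq_zero : ∀ S, ¬ (S.Nonempty ∧ S ⊂ M) → c S = 0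
  chi_eq : chi M = ∑ S, c S • chi S

theorem vec_self {M : Finset N} {c : Finset N → ℝ} (hc : IsRepr M c) (hM : M.Nonempty) :
    vec M c M = 1 := by
  simp [vec, hM.ne_empty, hc.eq_zero M (fun h => h.2.ne rfl)]

theorem vec_apply {M S : Finset N} {c : Finset N → ℝ} (hS : S.Nonempty) (h : S ≠ M) :
    vec M c S = -c S := by
  simp [vec, hS.ne_empty, h]

theorem vec_mem_coneOn {M : Finset N} {c : Finset N → ℝ} (hc : IsRepr M c) :
    vec M c ∈ coneOn M := by
  refine ⟨fun S hS hSM => ?_, fun R hR => ?_, ?_, ?_⟩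
  · rw [vec_apply hS hSM.ne]
    exact neg_nonpos.2 (hc.nonneg S)
  · have h1 : R ≠ M := fun h => hR h.subset
    have h2 : R.Nonempty := by
      rw [nonempty_iff_ne_empty]; rintro rfl; exact hR (empty_subset _)
    rw [vec_apply h2 h1, hc.eq_zero R fun h => hR h.2.subset, neg_zero]
  · simp [vec, sum_add_distrib]
  · simp only [vec, add_smul, sub_smul, sum_add_distrib, sum_sub_distrib, ← hc.chi_eq, ite_smul,
      zero_smul, one_smul, sum_ite_eq', mem_univ, if_true, chi_empty, smul_zero]
    simp

theorem vec_empty_pos {M : Finset N} {c : Finset N → ℝ} (hc : IsRepr M c) (hM : M.Nonempty) :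
    0 < vec M c ∅ := by
  obtain ⟨h1, h2⟩ := apply_empty_nonneg (vec_mem_coneOn hc)
  refine lt_of_le_of_ne h1 fun h => ?_
  have h3 := congrFun (h2 h.symm) M
  rw [vec_self hc hM] at h3
  exact one_ne_zero h3

/-- Elements of `coneOn M` are determined by their values on non-empty sets. -/
theorem eq_of_forall_nonempty {x y : Finset N → ℝ} (hx : ∑ S, x S = 0) (hy : ∑ S, y S = 0)
    (h : ∀ S : Finset N, S.Nonempty → x S = y S) : x = y := by
  funext S
  obtain rfl | hS := S.eq_empty_or_nonempty
  · rw [← add_sum_erase _ _ (mem_univ ∅)] at hx hy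
    have : ∑ S ∈ (univ : Finset (Finset N)).erase ∅, x S = ∑ S ∈ univ.erase ∅, y S :=
      sum_congr rfl fun S hS => h S (nonempty_iff_ne_empty.2 (ne_of_mem_erase hS))
    linarith
  · exact h S hS

theorem IsWeight.isRepr {B : Finset (Finset N)} (hB : IsMinBalanced B) (hn : IsNontrivial B)
    {w : Finset N → ℝ} (hw : IsWeight B w) : IsRepr (carrier B) w where
  nonneg := hw.nonneg
  eq_zero S hS := hw.2.1 S fun h => hS ⟨hB.nonempty_of_mem h, hB.ssubset_of_mem hn h⟩
  chi_eq := hw.chi_carrier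

theorem alpha_eq {B : Finset (Finset N)} (hB : IsMinBalanced B) (hn : IsNontrivial B) :
    alpha B = (scale B : ℝ) • vec (carrier B) (weight B) := by
  have hw := isWeight_weight hB
  have hr := hw.isRepr hB hn
  have hsum : ∑ T ∈ B, weight B T = ∑ T, weight B T :=
    sum_subset (subset_univ B) fun S _ hS => hw.2.1 S hS
  funext S
  simp only [alpha, Pi.smul_apply, smul_eq_mul]
  split_ifs with h1 h2 h3
  · rw [h1, vec_self hr hB.carrier_nonempty, mul_one]
  · rw [vec_apply (hB.nonempty_of_mem h2) h1]; ring
  · subst h3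
    simp only [vec, h1, if_false, if_true, hw.2.1 ∅ h2, hsum]; ring
  · rw [vec_apply (nonempty_iff_ne_empty.2 h3) h1, hw.2.1 S h2]; simp

/-- The integer scaling cancels under normalization, so arithmetic of the weights plays no further
role. -/
theorem inv_smul_alpha {B : Finset (Finset N)} (hB : IsMinBalanced B) (hn : IsNontrivial B) :
    (alpha B ∅)⁻¹ • alpha B =
      (vec (carrier B) (weight B) ∅)⁻¹ • vec (carrier B) (weight B) := by
  have hk : (scale B : ℝ) ≠ 0 := by
    have := (isScale_scale hB).1
    positivity
  rw [alpha_eq hB hn, smul_smul, Pi.smul_apply, smul_eq_mul, mul_inv, mul_comm, ← mul_assoc,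
    mul_inv_cancel₀ hk, one_mul]

theorem deltaOn_subset_delta {M : Finset N} (hM : 2 ≤ M.card) : DeltaOn M ⊆ Delta N :=
  (Set.subset_biUnion_of_mem (u := DeltaOn) (show M ∈ {M : Finset N | 2 ≤ M.card} from hM)).trans
    (subset_convexHull ℝ _)

theorem inv_smul_mem_delta {M : Finset N} (hM : 2 ≤ M.card) {u : Finset N → ℝ}
    (hu : u ∈ coneOn M) (h0 : 0 < u ∅) : (u ∅)⁻¹ • u ∈ Delta N :=
  deltaOn_subset_delta hM <| mem_deltaOn_iff.2
    ⟨smul_mem_coneOn (by positivity) hu, by simp [h0.ne']⟩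

/-! ### Extreme points come from irreducible systems. -/

/-- A cone component of an extreme point of `Delta` is a multiple of it. -/
theorem eq_smul_of_add_eq {θ u v : Finset N → ℝ} (hθ : θ ∈ Set.extremePoints ℝ (Delta N))
    (h1 : θ ∅ = 1) {A D : Finset N} (hA : 2 ≤ A.card) (hD : 2 ≤ D.card) (hu : u ∈ coneOn A)
    (hv : v ∈ coneOn D) (h : u + v = θ) (hu0 : 0 < u ∅) : u = u ∅ • θ := by
  have hs : u ∅ + v ∅ = 1 := by rw [← h1, ← h]; rfl
  obtain ⟨hv1, hv2⟩ := apply_empty_nonneg hv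
  obtain hv0 | hv0 := hv1.eq_or_lt
  · have hv' := hv2 hv0.symm
    rw [hv', add_zero] at h
    rw [h, h1, one_smul]
  -- `θ` is the convex combination of the normalized `u` and `v` with weights `u ∅` and `v ∅`.
  · have key : (u ∅)⁻¹ • u = θ := by
      refine (mem_extremePoints_iff_left.1 hθ).2 _ (inv_smul_mem_delta hA hu hu0) _
        (inv_smul_mem_delta hD hv hv0) ⟨u ∅, v ∅, hu0, hv0, hs, ?_⟩
      rw [smul_inv_smul₀ hu0.ne', smul_inv_smul₀ hv0.ne', h]
    rw [← key, smul_inv_smul₀ hu0.ne']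

/-- The sets other than the carrier on which a vector of `coneOn M` is negative. -/
noncomputable def supp (M : Finset N) (θ : Finset N → ℝ) : Finset (Finset N) :=
  univ.filter fun S => S.Nonempty ∧ S ⊂ M ∧ θ S ≠ 0

theorem mem_supp {M : Finset N} {θ : Finset N → ℝ} {S : Finset N} :
    S ∈ supp M θ ↔ S.Nonempty ∧ S ⊂ M ∧ θ S ≠ 0 := by simp [supp]

theorem smul_chi_self {M : Finset N} {θ : Finset N → ℝ} (hθ : θ ∈ coneOn M) :
    θ M • chi M = ∑ S ∈ supp M θ, (-θ S) • chi S := by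
  have h := hθ.2.2.2
  rw [← add_sum_erase _ _ (mem_univ M), add_eq_zero_iff_eq_neg, ← sum_neg_distrib] at h
  rw [h]
  symm
  simp only [← neg_smul]
  refine sum_subset (fun S hS => ?_) fun S hS hS' => ?_
  · simpa using (mem_supp.1 hS).2.1.ne
  · obtain rfl | hne := S.eq_empty_or_nonempty
    · rw [chi_empty, smul_zero]
    · have : θ S = 0 := by
        by_contra h0
        by_cases hsub : S ⊆ M
        · exact hS' (mem_supp.2 ⟨hne, hsub.ssubset_of_ne (ne_of_mem_erase hS), h0⟩)
        · exact h0 (hθ.2.1 S hsub)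
      rw [this, neg_zero, zero_smul]

theorem chi_mem_cone_supp {M : Finset N} {θ : Finset N → ℝ} (hθ : θ ∈ coneOn M)
    (h0 : 0 < θ M) : chi M ∈ cone (supp M θ) := by
  refine mem_cone_of_eq (c := fun S => (θ M)⁻¹ * (-θ S)) (fun S hS => ?_) ?_
  · have h := mem_supp.1 hS
    have := hθ.1 S h.1 h.2.1
    exact mul_nonneg (by positivity) (by linarith)
  · simp only [mul_smul, ← smul_sum, ← smul_chi_self hθ]
    rw [inv_smul_smul₀ h0.ne']

theorem carrier_supp {M : Finset N} {θ : Finset N → ℝ} (hθ : θ ∈ coneOn M)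
    (h0 : 0 < θ M) : carrier (supp M θ) = M := by
  refine Subset.antisymm (fun i hi => ?_) fun i hi => ?_
  · obtain ⟨S, hS, hiS⟩ := mem_carrier.1 hi
    exact (mem_supp.1 hS).2.1.subset hiS
  · by_contra hn
    have h := congrFun (smul_chi_self hθ) i
    simp only [Pi.smul_apply, chi, hi, if_true, smul_eq_mul, mul_one, Finset.sum_apply] at h
    rw [sum_eq_zero fun S hS => ?_] at h
    · exact h0.ne' h
    · rw [if_neg fun hiS => hn (mem_carrier.2 ⟨S, hS, hiS⟩), mul_zero]

theorem isRepr_of_support {B : Finset (Finset N)} {M : Finset N} {c : Finset N → ℝ}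
    (hB : ∀ S ∈ B, S.Nonempty ∧ S ⊂ M) (hc : ∀ S, 0 ≤ c S) (h0 : ∀ S ∉ B, c S = 0)
    (h : chi M = ∑ S, c S • chi S) : IsRepr M c where
  nonneg := hc
  eq_zero S hS := h0 S fun hSB => hS (hB S hSB)
  chi_eq := h

theorem isMinBalanced_supp {M : Finset N} (hM : 2 ≤ M.card) {θ : Finset N → ℝ}
    (hext : θ ∈ Set.extremePoints ℝ (Delta N)) (hθ : θ ∈ coneOn M) (h1 : θ ∅ = 1)
    (h0 : 0 < θ M) : IsMinBalanced (supp M θ) := by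
  have hMne : M.Nonempty := card_pos.1 (by omega)
  have hcar := carrier_supp hθ h0
  refine ⟨?_, ?_, fun C hC hle S hS => ?_⟩
  · obtain ⟨i, hi⟩ := hMne
    rw [← hcar] at hi
    obtain ⟨S, hS, -⟩ := mem_carrier.1 hi
    exact ⟨S, hS⟩
  · rw [hcar]; exact chi_mem_cone_supp hθ h0
  · rw [hcar] at hC
    obtain ⟨c, hc, hc0, hx⟩ := mem_cone_iff.1 hC
    have hr : IsRepr M c := isRepr_of_support
      (fun S hS => ⟨(mem_supp.1 (hle hS)).1, (mem_supp.1 (hle hS)).2.1⟩) hc hc0 hx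
    -- `ε` is so small that subtracting `ε • vec M c` keeps `θ` non-positive on its support.
    obtain ⟨ε, hε, hεS⟩ := exists_pos_forall_mul_le (supp M θ) c (fun S => -θ S) fun S hS => by
      have h := mem_supp.1 hS
      have := lt_of_le_of_ne (hθ.1 S h.1 h.2.1) h.2.2
      linarith
    have hu := smul_mem_coneOn hε.le (vec_mem_coneOn hr)
    have hv : θ - ε • vec M c ∈ coneOn M := by
      refine ⟨fun S hS hSM => ?_, fun R hR => ?_, ?_, ?_⟩
      · simp only [Pi.sub_apply, Pi.smul_apply, smul_eq_mul, vec_apply hS hSM.ne]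
        by_cases h : S ∈ supp M θ
        · linarith [hεS S h]
        · rw [hc0 S fun h' => h (hle h')]
          simpa using hθ.1 S hS hSM
      · have := hu.2.1 R hR
        simp only [Pi.sub_apply, this, hθ.2.1 R hR, sub_zero]
      · simp only [Pi.sub_apply, sum_sub_distrib, hu.2.2.1, hθ.2.2.1, sub_zero]
      · simp only [Pi.sub_apply, sub_smul, sum_sub_distrib, hu.2.2.2, hθ.2.2.2, sub_zero]
    have hpos : 0 < (ε • vec M c) ∅ := mul_pos hε (vec_empty_pos hr hMne)
    -- For `S` in the support but outside `C`, proportionality reads `0` on one side and a non-zero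
    -- multiple of `θ S` on the other.
    have key := congrFun (eq_smul_of_add_eq hext h1 hM hM hu hv (by abel) hpos) S
    by_contra hSC
    have hs := mem_supp.1 hS
    simp only [Pi.smul_apply, smul_eq_mul, vec_apply hs.1 hs.2.1.ne, hc0 S hSC] at key hpos
    rw [neg_zero, mul_zero, eq_comm, mul_eq_zero] at key
    exact key.elim hpos.ne' hs.2.2

theorem eq_smul_vec {M : Finset N} {θ : Finset N → ℝ} {B : Finset (Finset N)}
    (hB : IsMinBalanced B) (hn : IsNontrivial B) (hcar : carrier B = M) (hθ : θ ∈ coneOn M)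
    (hsub : supp M θ ⊆ B) {w : Finset N → ℝ} (hw : IsWeight B w) : θ = θ M • vec M w := by
  subst hcar
  have hr := hw.isRepr hB hn
  -- The terms added to `w` cancel in the sum, so uniqueness of weights applies without dividing by
  -- `θ (carrier B)`.
  have hv : ∀ S ∈ B, w S - θ S - θ (carrier B) * w S = w S := by
    refine eq_of_isMinBalanced hB hw ?_
    have h1 : ∑ S ∈ B, θ S • chi S = -(θ (carrier B) • chi (carrier B)) := by
      rw [← neg_eq_iff_eq_neg, ← sum_neg_distrib]
      simp only [← neg_smul _ (chi _)]
      rw [smul_chi_self hθ]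
      symm
      refine sum_subset hsub fun S hS hS' => ?_
      have : θ S = 0 := by
        by_contra h
        exact hS' (mem_supp.2 ⟨hB.nonempty_of_mem hS, hB.ssubset_of_mem hn hS, h⟩)
      rw [this, neg_zero, zero_smul]
    simp only [sub_eq_add_neg, add_smul, sum_add_distrib, h1, neg_smul, sum_neg_distrib, mul_smul,
      ← smul_sum, ← hw.2.2]
    abel
  refine eq_of_forall_nonempty hθ.2.2.1 ?_ fun S hS => ?_
  · simp only [Pi.smul_apply, smul_eq_mul, ← mul_sum, (vec_mem_coneOn hr).2.2.1, mul_zero]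
  · simp only [Pi.smul_apply, smul_eq_mul]
    by_cases hSM : S = carrier B
    · rw [hSM, vec_self hr hB.carrier_nonempty, mul_one]
    · rw [vec_apply hS hSM]
      by_cases hSB : S ∈ B
      · linarith [hv S hSB]
      · rw [hw.2.1 S hSB, neg_zero, mul_zero]
        by_contra h
        by_cases hle : S ⊆ carrier B
        · exact hSB (hsub (mem_supp.2 ⟨hS, hle.ssubset_of_ne hSM, h⟩))
        · exact h (hθ.2.1 S hle)

theorem not_isReducible {M : Finset N} (hM : 2 ≤ M.card) {θ : Finset N → ℝ}
    (hext : θ ∈ Set.extremePoints ℝ (Delta N)) (h1 : θ ∅ = 1) {B : Finset (Finset N)}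
    (hB : IsMinBalanced B) (hn : IsNontrivial B) (hcar : carrier B = M) {w : Finset N → ℝ}
    (hw : IsWeight B w) {t : ℝ} (ht : 0 < t) (hθ : θ = t • vec M w) : ¬ IsReducible B := by
  rintro ⟨A, hA, T, hT, hchiA, hchiM⟩
  subst hcar
  have hT' := mem_filter.1 hT
  have hTne := hB.nonempty_of_mem hT'.1
  have hAne : A.Nonempty := hTne.mono hT'.2.subset
  have hAc : 2 ≤ A.card := by
    have := card_lt_card hT'.2
    have := hTne.card_pos
    omega
  obtain ⟨a, ha, ha0, hax⟩ := mem_cone_iff.1 hchiA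
  obtain ⟨c, hc, hc0, hcx⟩ := mem_cone_iff.1 hchiM
  have hra : IsRepr A a := isRepr_of_support
    (fun S hS => ⟨hB.nonempty_of_mem (mem_filter.1 hS).1, (mem_filter.1 hS).2⟩) ha ha0 hax
  have hrc : IsRepr (carrier B) c := by
    refine isRepr_of_support (fun S hS => ?_) hc hc0 hcx
    rcases mem_insert.1 hS with rfl | hS
    · exact ⟨hAne, hA⟩
    · exact ⟨hB.nonempty_of_mem (mem_of_mem_erase hS),
        hB.ssubset_of_mem hn (mem_of_mem_erase hS)⟩
  -- Substituting the representation of `A` into that of the carrier leaves only sets of `B`, so it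
  -- must give the weights.
  have hwc : (fun S => c S - (if S = A then c A else 0) + c A * a S) = w := by
    refine hw.eq_of_sum_eq hB (fun S hS => ?_) ?_
    · have h2 : a S = 0 := ha0 S fun h => hS (mem_filter.1 h).1
      by_cases h : S = A
      · subst h; simp [h2]
      · have : c S = 0 := hc0 S fun h' => by
          rcases mem_insert.1 h' with h' | h'
          exacts [h h', hS (mem_of_mem_erase h')]
        simp [h, h2, this]
    · simp only [add_smul, sub_smul, sum_add_distrib, sum_sub_distrib, ite_smul, zero_smul,
        sum_ite_eq', mem_univ, if_true, mul_smul, ← smul_sum, ← hax, ← hcx]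
      abel
  have hcT : c T = 0 := hc0 T fun h => by
    rcases mem_insert.1 h with h | h
    exacts [hT'.2.ne h, notMem_erase T B h]
  -- `T` is absent from the second representation, so its positive weight can only come through `A`.
  have hcA : 0 < c A := by
    have h2 := congrFun hwc T
    simp only [hcT, hT'.2.ne, if_false, sub_zero, zero_add] at h2
    have h3 := hw.1 T hT'.1
    refine lt_of_le_of_ne (hc A) fun h => ?_
    rw [← h, zero_mul] at h2
    linarith
  have hsplit : vec (carrier B) w = c A • vec A a + vec (carrier B) c := by
    have hv1 := (vec_mem_coneOn (hw.isRepr hB hn)).2.2.1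
    have hv2 := (vec_mem_coneOn hra).2.2.1
    have hv3 := (vec_mem_coneOn hrc).2.2.1
    refine eq_of_forall_nonempty hv1 ?_ fun S hS => ?_
    · simp [sum_add_distrib, ← mul_sum, hv2, hv3]
    · rw [← congrFun (congrArg (vec (carrier B)) hwc) S]
      simp only [vec, hS.ne_empty, if_false, Pi.add_apply, Pi.smul_apply, smul_eq_mul]
      split_ifs <;> ring
  have htc : 0 < t * c A := mul_pos ht hcA
  have hu := smul_mem_coneOn htc.le (vec_mem_coneOn hra)
  have hpos : 0 < ((t * c A) • vec A a) ∅ := mul_pos htc (vec_empty_pos hra hAne)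
  have key := congrFun (eq_smul_of_add_eq hext h1 hAc hM hu
    (smul_mem_coneOn ht.le (vec_mem_coneOn hrc))
    (by rw [hθ, hsplit, smul_add, smul_smul]) hpos) (carrier B)
  -- The component in `coneOn A` vanishes at the carrier, while `θ` does not.
  rw [hu.2.1 (carrier B) hA.not_subset, hθ] at key
  simp only [Pi.smul_apply, smul_eq_mul, vec_self (hw.isRepr hB hn) hB.carrier_nonempty] at key
  have : 0 < (t * c A * vec A a ∅) * (t * 1) := by
    have : 0 < t * c A * vec A a ∅ := hpos
    positivity
  linarith

theorem exists_of_mem_extremePoints {θ : Finset N → ℝ}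
    (hext : θ ∈ Set.extremePoints ℝ (Delta N)) :
    ∃ M : Finset N, 2 ≤ M.card ∧ ∃ B : Finset (Finset N),
      IsMinBalancedOn B M ∧ IsNontrivial B ∧ IsIrreducible B ∧
      θ = (alpha B ∅)⁻¹ • alpha B := by
  have hmem := extremePoints_convexHull_subset hext
  simp only [Set.mem_iUnion, Set.mem_ofPred_eq] at hmem
  obtain ⟨M, hM, hθM⟩ := hmem
  obtain ⟨hθ, h1⟩ := mem_deltaOn_iff.1 hθM
  have h0 : 0 < θ M := by
    refine lt_of_le_of_ne (apply_self_nonneg hθ) fun h => ?_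
    rw [eq_zero_of_apply_self hθ h.symm] at h1
    exact zero_ne_one h1
  have hB := isMinBalanced_supp hM hext hθ h1 h0
  have hcar := carrier_supp hθ h0
  -- A single set would equal the carrier `M`, but the support has only proper subsets of `M`.
  have hn : IsNontrivial (supp M θ) := by
    by_contra h
    have h2 : ¬ 2 ≤ (supp M θ).card := h
    have h3 : (supp M θ).card = 1 := by
      have := hB.1.card_pos
      omega
    obtain ⟨S, hS⟩ := card_eq_one.1 h3
    have h4 : S ⊂ M := (mem_supp.1 (hS ▸ mem_singleton_self S : S ∈ supp M θ)).2.1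
    rw [hS] at hcar
    exact h4.ne (by simpa [carrier] using hcar)
  have hw := isWeight_weight hB
  have heq := eq_smul_vec hB hn hcar hθ Subset.rfl hw
  refine ⟨M, hM, supp M θ, ⟨hB, hcar⟩, hn,
    ⟨hB, not_isReducible hM hext h1 hB hn hcar hw h0 heq⟩, ?_⟩
  rw [inv_smul_alpha hB hn, hcar]
  have h2 : θ M * vec M (weight (supp M θ)) ∅ = 1 := by
    rw [← h1]
    exact (congrFun heq ∅).symm
  rw [← eq_inv_of_mul_eq_one_left h2]
  exact heq

/-! ### Irreducible systems give extreme points. -/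

/-- The second condition of reducibility comes for free by an exchange: trade as much as possible of
the weights `w` along `a` for a multiple of `chi A`. The ratio test `w S / a S` picks the set `T`
whose weight is used up first. -/
theorem isReducible_of_chi_mem {B : Finset (Finset N)} {w : Finset N → ℝ}
    (hw : IsWeight B w) {A : Finset N} (hA : A ⊂ carrier B)
    (hAne : A.Nonempty) (hmem : chi A ∈ cone (below B A)) : IsReducible B := by
  obtain ⟨a, ha, ha0, hax⟩ := mem_cone_iff.1 hmem
  have hne : ((below B A).filter fun S => 0 < a S).Nonempty := by
    by_contra h
    rw [not_nonempty_iff_eq_empty, filter_eq_empty_iff] at h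
    obtain ⟨i, hi⟩ := hAne
    have h2 : ∀ S, a S = 0 := fun S => by
      by_cases hS : S ∈ below B A
      · exact le_antisymm (not_lt.1 (h hS)) (ha S)
      · exact ha0 S hS
    have h3 := congrFun hax i
    simp [h2, chi, hi] at h3
  obtain ⟨T, hT, hmin⟩ := exists_min_image _ (fun S => w S / a S) hne
  obtain ⟨hTA, haT⟩ := mem_filter.1 hT
  have hTA' := mem_filter.1 hTA
  refine ⟨A, hA, T, hTA, hmem, ?_⟩
  have hs : 0 ≤ w T / a T := div_nonneg (hw.nonneg T) haT.le
  rw [mem_cone_iff]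
  refine ⟨fun S => (if S = A then w T / a T else 0) + (w S - w T / a T * a S), fun S => ?_,
    fun S hS => ?_, ?_⟩
  · have h1 : 0 ≤ w S - w T / a T * a S := by
      by_cases hS : S ∈ below B A ∧ 0 < a S
      · have := hmin S (mem_filter.2 hS)
        rw [le_div_iff₀ hS.2] at this
        linarith
      · have : a S = 0 := by
          by_cases hS' : S ∈ below B A
          · exact le_antisymm (not_lt.1 fun h => hS ⟨hS', h⟩) (ha S)
          · exact ha0 S hS'
        rw [this, mul_zero, sub_zero]
        exact hw.nonneg S
    dsimp only
    split_ifs <;> linarith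
  · rw [mem_insert, mem_erase, not_or, not_and_or, not_not] at hS
    rcases hS with ⟨hSA, rfl | hSB⟩
    · simp only [hSA, if_false, div_mul_cancel₀ _ haT.ne']
      ring
    · simp [hSA, hw.2.1 S hSB, ha0 S fun h => hSB (mem_filter.1 h).1]
  · simp only [add_smul, sub_smul, sum_add_distrib, sum_sub_distrib, ite_smul, zero_smul,
      sum_ite_eq', mem_univ, if_true, mul_smul, ← smul_sum, ← hax, ← hw.chi_carrier]
    abel

/-- In a decomposition of the vector of an irreducible system into cone components only the
component of the carrier is non-zero. -/
theorem eq_zero_of_sum_eq {B : Finset (Finset N)} (hB : IsIrreducible B) (hn : IsNontrivial B)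
    {w : Finset N → ℝ} (hw : IsWeight B w) {t : ℝ} (ht : 0 < t)
    {y : Finset N → Finset N → ℝ} (hy : ∀ A, y A ∈ coneOn A)
    (hsum : ∑ A, y A = t • vec (carrier B) w) {A : Finset N} (hA : A ≠ carrier B) : y A = 0 := by
  have hr := hw.isRepr hB.1 hn
  have hsum' : ∀ S, ∑ D, y D S = t * vec (carrier B) w S := fun S => by
    have := congrFun hsum S
    simpa using this
  have hpos : ∀ D, y D ≠ 0 → 0 < y D D := fun D hD =>
    lt_of_le_of_ne (apply_self_nonneg (hy D)) fun h => hD (eq_zero_of_apply_self (hy D) h.symm)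
  have hnon : ∀ D, y D ≠ 0 → D.Nonempty := fun D hD => by
    rw [nonempty_iff_ne_empty]
    rintro rfl
    exact hD (eq_zero_of_mem_coneOn_empty (hy ∅))
  have hsub : ∀ D, y D ≠ 0 → D ⊆ carrier B := by
    intro D hD
    -- For a maximal `E` only `y E` contributes at `E`, positively; the target vector is
    -- non-positive at non-empty sets other than the carrier.
    obtain ⟨E, hDE, hE⟩ := (univ.filter fun E => y E ≠ 0).exists_le_maximal
      (mem_filter.2 ⟨mem_univ D, hD⟩)
    have hE0 : y E ≠ 0 := (mem_filter.1 hE.prop).2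
    have h := hsum' E
    rw [sum_eq_single E (fun F _ hF => ?_) (by simp)] at h
    · by_cases hEM : E = carrier B
      · exact hEM ▸ hDE
      · rw [vec_apply (hnon E hE0) hEM] at h
        have h1 := hpos E hE0
        have h2 := mul_nonneg ht.le (hw.nonneg E)
        linarith
    · by_cases hEF : E ⊆ F
      · have : y F = 0 := by
          by_contra hF0
          exact hF (Subset.antisymm (hE.le_of_ge (mem_filter.2 ⟨mem_univ F, hF0⟩) hEF) hEF)
        rw [this, Pi.zero_apply]
      · exact (hy F).2.1 E hEF
  by_contra hA0
  -- For a minimal `E` the support of `y E` lies in `B`, making `B` reducible: at `S ⊂ E` the only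
  -- possibly positive term `y S S` is zero by minimality, so nothing cancels a negative value off
  -- `B`.
  obtain ⟨E, -, hE⟩ := (univ.filter fun E => y E ≠ 0 ∧ E ≠ carrier B).exists_le_minimal
    (mem_filter.2 ⟨mem_univ A, hA0, hA⟩)
  obtain ⟨hE0, hEM⟩ := (mem_filter.1 hE.prop).2
  have hEss : E ⊂ carrier B := (hsub E hE0).ssubset_of_ne hEM
  refine hB.2 (isReducible_of_chi_mem hw hEss (hnon E hE0) ?_)
  refine Submodule.span_mono (Set.image_mono fun S hS => ?_)
    (chi_mem_cone_supp (hy E) (hpos E hE0))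
  obtain ⟨hSne, hSE, hS0⟩ := mem_supp.1 hS
  have hSM : S ≠ carrier B := (hSE.trans hEss).ne
  refine mem_filter.2 ⟨?_, hSE⟩
  by_contra hSB
  have h := hsum' S
  rw [vec_apply hSne hSM, hw.2.1 S hSB, neg_zero, mul_zero, sum_eq_zero_iff_of_nonpos] at h
  · exact hS0 (h E (mem_univ E))
  · intro D _
    by_cases hSD : S = D
    · subst hSD
      have : y S = 0 := by
        by_contra hS1
        exact hSE.not_subset (hE.le_of_le (mem_filter.2 ⟨mem_univ S, hS1, hSM⟩) hSE.subset)
      simp [this]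
    · exact apply_nonpos_of_mem_coneOn (hy D) hSne hSD

/-- Each cone is closed under addition, so the terms of a convex combination can be grouped into one
component per set. -/
theorem exists_decomposition {x : Finset N → ℝ} (hx : x ∈ Delta N) :
    x ∅ = 1 ∧ ∃ y : Finset N → Finset N → ℝ, (∀ A, y A ∈ coneOn A) ∧ ∑ A, y A = x := by
  let D : Set (Finset N → ℝ) :=
    {x | x ∅ = 1 ∧ ∃ y : Finset N → Finset N → ℝ, (∀ A, y A ∈ coneOn A) ∧ ∑ A, y A = x}
  refine (convexHull_min (t := D) ?_ ?_ : Delta N ⊆ D) hx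
  · refine Set.iUnion₂_subset fun M _ z hz => ?_
    obtain ⟨hz1, hz2⟩ := mem_deltaOn_iff.1 hz
    refine ⟨hz2, fun A => if A = M then z else 0, fun A => ?_, by simp⟩
    dsimp only
    split_ifs with h
    exacts [h ▸ hz1, zero_mem_coneOn A]
  · rintro x ⟨hx, y, hy, rfl⟩ x' ⟨hx', y', hy', rfl⟩ a b ha hb hab
    refine ⟨?_, fun A => a • y A + b • y' A, fun A => add_mem_coneOn
      (smul_mem_coneOn ha (hy A)) (smul_mem_coneOn hb (hy' A)), ?_⟩
    · rw [Pi.add_apply, Pi.smul_apply, Pi.smul_apply, hx, hx']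
      simpa using hab
    · simp [sum_add_distrib, smul_sum]

theorem mem_extremePoints_of_isIrreducible {B : Finset (Finset N)} (hB : IsIrreducible B)
    (hn : IsNontrivial B) (hM : 2 ≤ (carrier B).card) :
    (alpha B ∅)⁻¹ • alpha B ∈ Set.extremePoints ℝ (Delta N) := by
  rw [inv_smul_alpha hB.1 hn]
  have hw := isWeight_weight hB.1
  have hr := hw.isRepr hB.1 hn
  have hpos := vec_empty_pos hr hB.1.carrier_nonempty
  have hv := vec_mem_coneOn hr
  set v := vec (carrier B) (weight B) with hvdef
  have ht : 0 < (v ∅)⁻¹ := inv_pos.2 hpos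
  refine mem_extremePoints_iff_left.2 ⟨inv_smul_mem_delta hM hv hpos, ?_⟩
  rintro x hx z hz ⟨a, b, ha, hb, hab, hxz⟩
  obtain ⟨hx1, p, hp, hpx⟩ := exists_decomposition hx
  obtain ⟨hz1, q, hq, hqz⟩ := exists_decomposition hz
  have hzero : ∀ A, A ≠ carrier B → a • p A + b • q A = 0 := by
    refine fun A hA => eq_zero_of_sum_eq (y := fun A => a • p A + b • q A) hB hn hw ht
      (fun A => add_mem_coneOn (smul_mem_coneOn ha.le (hp A)) (smul_mem_coneOn hb.le (hq A)))
      ?_ hA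
    rw [← hvdef, ← hxz, ← hpx, ← hqz]
    simp [sum_add_distrib, smul_sum]
  -- Both components are non-negative at `A`, so neither can cancel the other there.
  have hpz : ∀ A, A ≠ carrier B → p A = 0 ∧ q A = 0 := by
    intro A hA
    have h := congrFun (hzero A hA) A
    simp only [Pi.add_apply, Pi.smul_apply, smul_eq_mul, Pi.zero_apply] at h
    have h1 := mul_nonneg ha.le (apply_self_nonneg (hp A))
    have h2 := mul_nonneg hb.le (apply_self_nonneg (hq A))
    exact ⟨eq_zero_of_apply_self (hp A) ((mul_eq_zero.1 (by linarith : a * p A A = 0)).resolve_left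
      ha.ne'), eq_zero_of_apply_self (hq A)
        ((mul_eq_zero.1 (by linarith : b * q A A = 0)).resolve_left hb.ne')⟩
  have hxM : x ∈ coneOn (carrier B) := by
    rw [← hpx, sum_eq_single (carrier B) (fun A _ hA => (hpz A hA).1) (by simp)]
    exact hp _
  have hzM : z ∈ coneOn (carrier B) := by
    rw [← hqz, sum_eq_single (carrier B) (fun A _ hA => (hpz A hA).2) (by simp)]
    exact hq _
  -- Off `B` two non-positive values average to zero, hence both vanish.
  have hsupp : supp (carrier B) x ⊆ B := by
    intro S hS
    obtain ⟨hSne, hSM, hS0⟩ := mem_supp.1 hS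
    by_contra hSB
    have h := congrFun hxz S
    simp only [Pi.add_apply, Pi.smul_apply, smul_eq_mul, hvdef, vec_apply hSne hSM.ne,
      hw.2.1 S hSB, neg_zero, mul_zero] at h
    have h1 := mul_nonpos_of_nonneg_of_nonpos ha.le (hxM.1 S hSne hSM)
    have h2 := mul_nonpos_of_nonneg_of_nonpos hb.le (hzM.1 S hSne hSM)
    exact (mul_ne_zero ha.ne' hS0) (by linarith)
  have heq := eq_smul_vec hB.1 hn rfl hxM hsupp hw
  rw [← hvdef] at heq
  have h2 : x (carrier B) * v ∅ = 1 := by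
    rw [← hx1]
    exact (congrFun heq ∅).symm
  rw [← eq_inv_of_mul_eq_one_left h2]
  exact heq

end MinBalanced

theorem mainTheorem2 {N : Type*} [Fintype N] [DecidableEq N] (θ : Finset N → ℝ) :
    θ ∈ Set.extremePoints ℝ (MinBalanced.Delta N) ↔
      ∃ M : Finset N, 2 ≤ M.card ∧ ∃ B : Finset (Finset N),
        MinBalanced.IsMinBalancedOn B M ∧ MinBalanced.IsNontrivial B ∧
        MinBalanced.IsIrreducible B ∧
        θ = (MinBalanced.alpha B ∅)⁻¹ • MinBalanced.alpha B := by
  refine ⟨MinBalanced.exists_of_mem_extremePoints, ?_⟩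
  rintro ⟨M, hM, B, ⟨-, rfl⟩, hn, hB, rfl⟩
  exact MinBalanced.mem_extremePoints_of_isIrreducible hB hn hM
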